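/- For probability measures $P,Q$ on the same space let $\mathrm{TV}(P\|Q)=\sup_A|P(A)-Q(A)|$ be the total variation distance. For $K\ge 1$ clients with original model parameters distributed as $P_k^{\mathcal O}$ and protected model parameters distributed as $P_k^{\mathcal D}$, the privacy leakage is $$\epsilon_p=\frac1K\sum_{k=1}^K\bigl(1-\mathrm{TV}(P_k^{\mathcal O}\|P_k^{\mathcal D})\bigr).$$ **Randomization.** There are absolute constants $0<c$, $0<C$ such that the following holds. Let $K\ge1$, let $d_w$ be the dimension of the model weights, $c_{\mathrm{clip}}>0$ the clip norm and $\sigma_{\mathrm{rd}}\ge 0$ the standard deviation of the noise. For every client $k$ let $P_k^{\mathcal O}=\mathcal N(\mu_k,c_{\mathrm{clip}}^2I_{d_w})$ with $\mu_k\in\mathbb R^{d_w}$, and let $P_k^{\mathcal D}$ be the law of $W_k^{\mathcal O}+Z_k$, where $W_k^{\mathcal O}\sim P_k^{\mathcal O}$ and $Z_k\sim\mathcal N(0,\sigma_{\mathrm{rd}}^2I_{d_w})$ are independent. Put $x=\frac{\sigma_{\mathrm{rd}}^2}{c_{\mathrm{clip}}^2}\sqrt{d_w}$. Then $$\epsilon_p=1-\min\{1,\theta\}\quad\text{for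 some }\theta\text{ with}\quad c\,\min\{1,x\}\le\theta\le C\,x .$$ In particular $\theta=\Theta(x)$ in the range $x\le 1$. **Sparsification.** For all $0<a\le b$ there are constants $0<c$, $0<C$, depending only on $a$ and $b$, such that the following holds. Let $K\ge1$ and let the weight vector of each client consist of $q$ shared and $r=n-q$ retained coordinates. For every client $k$ let $$P_k^{\mathcal O}=\mathcal N\bigl((\mu_{u,k},\mu_{o,k}),\ \Sigma_{0,k}\bigr),\quad \Sigma_{0,k}=\mathrm{diag}(\Sigma_{u,k},\Sigma_{o,k}),\qquad P_k^{\mathcal D}=\mathcal N\bigl((\mu_{u,k},\mu_{g,k}),\ \Sigma_k\bigr),\quad \Sigma_k=\mathrm{diag}(\Sigma_{u,k},\Sigma_{g,k}),$$ where $\Sigma_{u,k}$, $\Sigma_{o,k}$, $\Sigma_{g,k}$ are diagonal, $\Sigma_{u,k}$ has positive diagonal entries, and the diagonal entries of $\Sigma_{o,k}$ and $\Sigma_{g,k}$ lie in $[a,b]$. Put $\mu_k=\mu_{o,k}-\mu_{g,k}\in\mathbb R^{r}$ (the mean vector of the retained weights, if $\mu_{g,k}=0$) and $$\delta_k=-\log\frac{\det(\Sigma_{0,k})^{1/4}\det(\Sigma_k)^{1/4}}{\det\bigl(\tfrac{\Sigma_{0,k}+\Sigma_k}{2}\bigr)^{1/2}}$$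 (which is $0$ if $\Sigma_{o,k}=\Sigma_{g,k}$). Then $$\epsilon_p=\frac1K\sum_{k=1}^K\Bigl(1-\sqrt2\,\bigl(1-\exp\{-f_k\}\bigr)^{1/2}\Bigr)$$ for some real numbers $f_k$ with $$c\,\min\{1,\|\mu_k\|^2\}\le f_k\le \delta_k+C\,\|\mu_k\|^2\quad\text{and}\quad f_k\le\delta_k+C\,\|\mu_k\| ,$$ where $\|\cdot\|$ is the Euclidean norm. -/

import Mathlib

open MeasureTheory ProbabilityTheory

noncomputable section

/-- Total variation distance `sup_A |P(A) - Q(A)|`, over measurable sets `A`. -/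
def tvDist {Ω : Type*} [MeasurableSpace Ω] (P Q : Measure Ω) : ℝ :=
  ⨆ A : {A : Set Ω // MeasurableSet A}, |P.real A - Q.real A|

/-- Privacy leakage `ε_p = (1/K) ∑ₖ (1 - TV(Pₖᴼ ‖ Pₖᴰ))` of `K` clients, where `PO k` and `PD k` are
the distributions of the original and of the protected model parameters of client `k`. -/
def privacyLeakage {Ω : Type*} [MeasurableSpace Ω] {K : ℕ} (PO PD : Fin K → Measure Ω) : ℝ :=
  (1 / (K : ℝ)) * ∑ k, (1 - tvDist (PO k) (PD k))

/-- Isotropic Gaussian `N(μ, s² I_d)` on `ℝ^d`, with standard deviation `s` per coordinate. -/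
def isoGaussian {d : ℕ} (μ : EuclideanSpace ℝ (Fin d)) (s : ℝ) :
    Measure (EuclideanSpace ℝ (Fin d)) :=
  multivariateGaussian μ (s ^ 2 • (1 : Matrix (Fin d) (Fin d) ℝ))

/-- Randomization: the law of `W + Z`, where `W ∼ P` and `Z ∼ N(0, σ² I_d)` are independent. -/
def randomize {d : ℕ} (σ : ℝ) (P : Measure (EuclideanSpace ℝ (Fin d))) :
    Measure (EuclideanSpace ℝ (Fin d)) :=
  Measure.conv P (isoGaussian 0 σ)

/-- Block-diagonal covariance matrix `diag(Σ₁, Σ₂)` with diagonal blocks; `v` and `w` are the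
variances of the coordinates of the first and of the second block. -/
def blockCov {q r : ℕ} (v : Fin q → ℝ) (w : Fin r → ℝ) :
    Matrix (Fin q ⊕ Fin r) (Fin q ⊕ Fin r) ℝ :=
  Matrix.fromBlocks (Matrix.diagonal v) 0 0 (Matrix.diagonal w)

/-- Gaussian `N((μ₁, μ₂), diag(Σ₁, Σ₂))` on `ℝ^q × ℝ^r`, with diagonal covariance. -/
def blockGaussian {q r : ℕ} (μ₁ : EuclideanSpace ℝ (Fin q)) (μ₂ : EuclideanSpace ℝ (Fin r))
    (v : Fin q → ℝ) (w : Fin r → ℝ) : Measure (EuclideanSpace ℝ (Fin q ⊕ Fin r)) :=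
  multivariateGaussian (WithLp.toLp 2 (Sum.elim μ₁ μ₂)) (blockCov v w)

/-- The covariance term `- log (det Σ₁ ^ (1/4) * det Σ₂ ^ (1/4) / det ((Σ₁ + Σ₂) / 2) ^ (1/2))` of
the Hellinger affinity of two Gaussians. It vanishes when `Σ₁ = Σ₂`. -/
def covGap {ι : Type*} [Fintype ι] [DecidableEq ι] (S₁ S₂ : Matrix ι ι ℝ) : ℝ :=
  -Real.log (S₁.det ^ (1 / 4 : ℝ) * S₂.det ^ (1 / 4 : ℝ) /
    ((1 / 2 : ℝ) • (S₁ + S₂)).det ^ (1 / 2 : ℝ))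

end

/-
The upper bounds come from the Hellinger affinity `∫ √(p q)`: restricting it to `{A, Aᶜ}` gives
`TV² ≤ 1 - affinity²`, it is multiplicative over coordinates, and for Gaussians with diagonal
covariances it equals `exp (-(covGap + ∑ᵢ (mᵢ - mᵢ')² / (4 (vᵢ + wᵢ))))`.

The lower bound for shifted means tests the half-space through one mean, orthogonal to the
difference of the means. For concentric isotropic Gaussians the
radial map `‖x - m‖² / s²` compares the `χ²` law `ν` with its dilation by `ρ = 1 + σ² / s²`, and the
tests `Iic (l * ρ ^ n)` telescope, so that `ν` puts mass at most `n * TV` on `(l, l * ρ ^ n]`. Since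
`ν` has mass bounded below on an interval of logarithmic length of order `1 / √d`, about
`1 / (√d * log ρ)` tests suffice.
-/

section TotalVariation

variable {Ω : Type*} [MeasurableSpace Ω]

lemma tvDist_nonneg (P Q : Measure Ω) : 0 ≤ tvDist P Q :=
  Real.iSup_nonneg fun _ => abs_nonneg _

lemma tvDist_le {P Q : Measure Ω} {B : ℝ}
    (h : ∀ A, MeasurableSet A → |P.real A - Q.real A| ≤ B) : tvDist P Q ≤ B :=
  haveI : Nonempty {A : Set Ω // MeasurableSet A} := ⟨⟨∅, .empty⟩⟩
  ciSup_le fun A => h A A.2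

variable (P Q : Measure Ω) [IsProbabilityMeasure P] [IsProbabilityMeasure Q]

lemma abs_measureReal_sub_le_one (A : Set Ω) : |P.real A - Q.real A| ≤ 1 :=
  abs_sub_le_of_nonneg_of_le measureReal_nonneg measureReal_le_one
    measureReal_nonneg measureReal_le_one

lemma tvDist_le_one : tvDist P Q ≤ 1 :=
  tvDist_le fun A _ => abs_measureReal_sub_le_one P Q A

lemma abs_measureReal_sub_le_tvDist {A : Set Ω} (hA : MeasurableSet A) :
    |P.real A - Q.real A| ≤ tvDist P Q :=
  le_ciSup (f := fun A : {A : Set Ω // MeasurableSet A} => |P.real A - Q.real A|)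
    ⟨1, by rintro _ ⟨A, rfl⟩; exact abs_measureReal_sub_le_one P Q A⟩ ⟨A, hA⟩

lemma measureReal_sub_le_tvDist {A : Set Ω} (hA : MeasurableSet A) :
    P.real A - Q.real A ≤ tvDist P Q :=
  (le_abs_self _).trans (abs_measureReal_sub_le_tvDist P Q hA)

lemma tvDist_map_le {Ω' : Type*} [MeasurableSpace Ω'] {g : Ω → Ω'} (hg : Measurable g) :
    tvDist (P.map g) (Q.map g) ≤ tvDist P Q :=
  tvDist_le fun A hA => by
    rw [map_measureReal_apply hg hA, map_measureReal_apply hg hA]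
    exact abs_measureReal_sub_le_tvDist P Q (hg hA)

end TotalVariation

section HellingerAffinity

variable {Ω : Type*} [MeasurableSpace Ω]

/-- Hellinger affinity `∫ √(p q) dμ` of the measures with densities `p` and `q` with respect to
`μ`; densities are real-valued and nonnegative. -/
noncomputable def hellingerAffinity (μ : Measure Ω) (p q : Ω → ℝ) : ℝ :=
  ∫ x, √(p x * q x) ∂μ

lemma hellingerAffinity_nonneg (μ : Measure Ω) (p q : Ω → ℝ) : 0 ≤ hellingerAffinity μ p q :=
  integral_nonneg fun _ => Real.sqrt_nonneg _

lemma hellingerAffinity_pi {ι : Type*} [Fintype ι] {Ω : ι → Type*} [∀ i, MeasurableSpace (Ω i)]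
    (μ : ∀ i, Measure (Ω i)) [∀ i, SigmaFinite (μ i)] {p q : ∀ i, Ω i → ℝ}
    (hp : ∀ i x, 0 ≤ p i x) (hq : ∀ i x, 0 ≤ q i x) :
    hellingerAffinity (Measure.pi μ) (fun x => ∏ i, p i (x i)) (fun x => ∏ i, q i (x i)) =
      ∏ i, hellingerAffinity (μ i) (p i) (q i) := by
  simp only [hellingerAffinity, ← Finset.prod_mul_distrib,
    Real.sqrt_prod _ fun i _ => mul_nonneg (hp i _) (hq i _)]
  exact integral_fintype_prod_eq_prod fun i x => √(p i x * q i x)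

variable {μ : Measure Ω} {p q : Ω → ℝ}

lemma memLp_two_sqrt (hp : Integrable p μ) (hp0 : ∀ x, 0 ≤ p x) :
    MemLp (fun x => √(p x)) 2 μ := by
  rw [memLp_two_iff_integrable_sq hp.aestronglyMeasurable.aemeasurable.sqrt.aestronglyMeasurable]
  simpa only [Real.sq_sqrt (hp0 _)] using hp

lemma integrable_sqrt_mul (hp : Integrable p μ) (hq : Integrable q μ) (hp0 : ∀ x, 0 ≤ p x)
    (hq0 : ∀ x, 0 ≤ q x) : Integrable (fun x => √(p x * q x)) μ := by
  simpa only [Pi.mul_def, Real.sqrt_mul (hp0 _)] using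
    (memLp_two_sqrt hp hp0).integrable_mul (memLp_two_sqrt hq hq0)

lemma hellingerAffinity_le_sqrt_mul_sqrt (hp : Integrable p μ) (hq : Integrable q μ)
    (hp0 : ∀ x, 0 ≤ p x) (hq0 : ∀ x, 0 ≤ q x) :
    hellingerAffinity μ p q ≤ √(∫ x, p x ∂μ) * √(∫ x, q x ∂μ) := by
  have holder := integral_mul_le_Lp_mul_Lq_of_nonneg (μ := μ) Real.HolderConjugate.two_two
    (.of_forall fun x => Real.sqrt_nonneg (p x)) (.of_forall fun x => Real.sqrt_nonneg (q x))
    (by simpa using memLp_two_sqrt hp hp0) (by simpa using memLp_two_sqrt hq hq0)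
  simpa only [hellingerAffinity, Real.sqrt_mul (hp0 _), Real.rpow_two, Real.sq_sqrt (hp0 _),
    Real.sq_sqrt (hq0 _), ← Real.sqrt_eq_rpow] using holder

lemma measureReal_withDensity_ofReal (hp : Integrable p μ) (hp0 : ∀ x, 0 ≤ p x) {A : Set Ω}
    (hA : MeasurableSet A) :
    (μ.withDensity fun x => ENNReal.ofReal (p x)).real A = ∫ x in A, p x ∂μ := by
  rw [Measure.real, withDensity_apply _ hA,
    ← ofReal_integral_eq_lintegral_ofReal hp.integrableOn (.of_forall hp0),
    ENNReal.toReal_ofReal (integral_nonneg hp0)]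

lemma sq_sub_le_one_sub_sq_of_le_sqrt_add_sqrt {a b β : ℝ} (ha : a ∈ Set.Icc 0 1)
    (hb : b ∈ Set.Icc 0 1) (hβ : 0 ≤ β) (h : β ≤ √a * √b + √(1 - a) * √(1 - b)) :
    (a - b) ^ 2 ≤ 1 - β ^ 2 := by
  have sq_a := Real.sq_sqrt ha.1
  have sq_b := Real.sq_sqrt hb.1
  have sq_a' := Real.sq_sqrt (sub_nonneg.2 ha.2)
  have sq_b' := Real.sq_sqrt (sub_nonneg.2 hb.2)
  calc (a - b) ^ 2
      ≤ (a - b) ^ 2 + (√a * √(1 - a) - √b * √(1 - b)) ^ 2 :=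
        le_add_of_nonneg_right (sq_nonneg _)
    _ = 1 - (√a * √b + √(1 - a) * √(1 - b)) ^ 2 := by
        simp only [sub_sq, add_sq, mul_pow, sq_a, sq_b, sq_a', sq_b']
        ring
    _ ≤ 1 - β ^ 2 := by gcongr

-- The affinity can only grow when the two measures are restricted to the partition `{A, Aᶜ}`,
-- which reduces the bound to two Bernoulli laws.
lemma sq_tvDist_withDensity_le (hp : Integrable p μ) (hq : Integrable q μ) (hp0 : ∀ x, 0 ≤ p x)
    (hq0 : ∀ x, 0 ≤ q x) [IsProbabilityMeasure (μ.withDensity fun x => ENNReal.ofReal (p x))]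
    [IsProbabilityMeasure (μ.withDensity fun x => ENNReal.ofReal (q x))] :
    tvDist (μ.withDensity fun x => ENNReal.ofReal (p x))
      (μ.withDensity fun x => ENNReal.ofReal (q x)) ^ 2 ≤ 1 - hellingerAffinity μ p q ^ 2 := by
  set P := μ.withDensity fun x => ENNReal.ofReal (p x)
  set Q := μ.withDensity fun x => ENNReal.ofReal (q x)
  have restrict_le : ∀ A, MeasurableSet A →
      ∫ x in A, √(p x * q x) ∂μ ≤ √(P.real A) * √(Q.real A) := fun A hA => by
    rw [measureReal_withDensity_ofReal hp hp0 hA, measureReal_withDensity_ofReal hq hq0 hA]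
    exact hellingerAffinity_le_sqrt_mul_sqrt hp.integrableOn hq.integrableOn hp0 hq0
  have sq_le : ∀ A, MeasurableSet A →
      (P.real A - Q.real A) ^ 2 ≤ 1 - hellingerAffinity μ p q ^ 2 := fun A hA => by
    refine sq_sub_le_one_sub_sq_of_le_sqrt_add_sqrt ⟨measureReal_nonneg, measureReal_le_one⟩
      ⟨measureReal_nonneg, measureReal_le_one⟩ (hellingerAffinity_nonneg μ p q) ?_
    rw [hellingerAffinity, ← integral_add_compl hA (integrable_sqrt_mul hp hq hp0 hq0),
      ← probReal_compl_eq_one_sub hA, ← probReal_compl_eq_one_sub hA]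
    exact add_le_add (restrict_le A hA) (restrict_le Aᶜ hA.compl)
  have hpos : 0 ≤ 1 - hellingerAffinity μ p q ^ 2 :=
    (sq_nonneg _).trans (sq_le ∅ .empty)
  rw [← Real.le_sqrt (tvDist_nonneg P Q) hpos]
  exact tvDist_le fun A hA => Real.abs_le_sqrt (sq_le A hA)

lemma pi_withDensity_ofReal {ι : Type*} [Fintype ι] {Ω : ι → Type*} [∀ i, MeasurableSpace (Ω i)]
    (μ : ∀ i, Measure (Ω i)) [∀ i, SigmaFinite (μ i)] {p : ∀ i, Ω i → ℝ}
    (hp : ∀ i, Integrable (p i) (μ i)) (hp0 : ∀ i x, 0 ≤ p i x) :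
    Measure.pi (fun i => (μ i).withDensity fun x => ENNReal.ofReal (p i x)) =
      (Measure.pi μ).withDensity fun x => ENNReal.ofReal (∏ i, p i (x i)) := by
  have hprod : Integrable (fun x => ∏ i, p i (x i)) (Measure.pi μ) := .fintype_prod_dep hp
  have := fun i => isFiniteMeasure_withDensity_ofReal (hp i).2
  refine Measure.pi_eq fun s hs => ?_
  rw [withDensity_apply _ (.univ_pi hs), Measure.restrict_pi_pi,
    ← ofReal_integral_eq_lintegral_ofReal (by
      rw [← Measure.restrict_pi_pi]; exact hprod.integrableOn)
      (.of_forall fun x => Finset.prod_nonneg fun i _ => hp0 i (x i)),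
    integral_fintype_prod_eq_prod p,
    ENNReal.ofReal_prod_of_nonneg fun i _ => integral_nonneg (hp0 i)]
  refine Finset.prod_congr rfl fun i _ => ?_
  rw [withDensity_apply _ (hs i),
    ofReal_integral_eq_lintegral_ofReal (hp i).integrableOn (.of_forall (hp0 i))]

lemma sq_tvDist_pi_withDensity_le {ι : Type*} [Fintype ι] {Ω : ι → Type*}
    [∀ i, MeasurableSpace (Ω i)] (μ : ∀ i, Measure (Ω i)) [∀ i, SigmaFinite (μ i)]
    {p q : ∀ i, Ω i → ℝ} (hp : ∀ i, Integrable (p i) (μ i)) (hq : ∀ i, Integrable (q i) (μ i))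
    (hp0 : ∀ i x, 0 ≤ p i x) (hq0 : ∀ i x, 0 ≤ q i x)
    [∀ i, IsProbabilityMeasure ((μ i).withDensity fun x => ENNReal.ofReal (p i x))]
    [∀ i, IsProbabilityMeasure ((μ i).withDensity fun x => ENNReal.ofReal (q i x))] :
    tvDist (Measure.pi fun i => (μ i).withDensity fun x => ENNReal.ofReal (p i x))
      (Measure.pi fun i => (μ i).withDensity fun x => ENNReal.ofReal (q i x)) ^ 2 ≤
      1 - (∏ i, hellingerAffinity (μ i) (p i) (q i)) ^ 2 := by
  rw [← hellingerAffinity_pi μ hp0 hq0]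
  have density_p := pi_withDensity_ofReal μ hp hp0
  have density_q := pi_withDensity_ofReal μ hq hq0
  have : IsProbabilityMeasure ((Measure.pi μ).withDensity fun x =>
      ENNReal.ofReal (∏ i, p i (x i))) := density_p ▸ inferInstance
  have : IsProbabilityMeasure ((Measure.pi μ).withDensity fun x =>
      ENNReal.ofReal (∏ i, q i (x i))) := density_q ▸ inferInstance
  rw [density_p, density_q]
  exact sq_tvDist_withDensity_le (.fintype_prod_dep hp) (.fintype_prod_dep hq)
    (fun x => Finset.prod_nonneg fun i _ => hp0 i (x i))
    fun x => Finset.prod_nonneg fun i _ => hq0 i (x i)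

end HellingerAffinity

section GaussianAffinity

/-- Hellinger affinity of two real Gaussians with the same mean and variances `v` and `w`. It is
the one-dimensional instance of the quotient whose logarithm defines `covGap`. -/
noncomputable def gaussianAffinity (v w : ℝ) : ℝ :=
  v ^ (1 / 4 : ℝ) * w ^ (1 / 4 : ℝ) / ((v + w) / 2) ^ (1 / 2 : ℝ)

lemma gaussianAffinity_pos {v w : ℝ} (hv : 0 < v) (hw : 0 < w) : 0 < gaussianAffinity v w := by
  unfold gaussianAffinity
  positivity

lemma gaussianAffinity_pow_four {v w : ℝ} (hv : 0 ≤ v) (hw : 0 ≤ w) :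
    gaussianAffinity v w ^ 4 = v * w / ((v + w) / 2) ^ 2 := by
  simp only [gaussianAffinity, div_pow, mul_pow, ← Real.rpow_mul_natCast hv,
    ← Real.rpow_mul_natCast hw, ← Real.rpow_mul_natCast (show 0 ≤ (v + w) / 2 by positivity)]
  norm_num [div_pow]

lemma gaussianAffinity_le_one {v w : ℝ} (hv : 0 < v) (hw : 0 < w) : gaussianAffinity v w ≤ 1 := by
  refine (pow_le_one_iff_of_nonneg (gaussianAffinity_pos hv hw).le four_ne_zero).1 ?_
  rw [gaussianAffinity_pow_four hv.le hw.le, div_le_one (by positivity)]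
  linarith [sq_nonneg (v - w)]

lemma neg_log_gaussianAffinity_le {v w : ℝ} (hv : 0 < v) (hw : 0 < w) :
    -Real.log (gaussianAffinity v w) ≤ (v - w) ^ 2 / (16 * (v * w)) := by
  have log_pow : Real.log (((v + w) / 2) ^ 2 / (v * w)) =
      4 * -Real.log (gaussianAffinity v w) := by
    rw [← inv_div, ← gaussianAffinity_pow_four hv.le hw.le, Real.log_inv, Real.log_pow]
    push_cast
    ring
  have log_le := Real.log_le_sub_one_of_pos
    (show 0 < ((v + w) / 2) ^ 2 / (v * w) by positivity)
  have sub_one : ((v + w) / 2) ^ 2 / (v * w) - 1 = 4 * ((v - w) ^ 2 / (16 * (v * w))) := by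
    field_simp
    ring
  linarith

lemma sqrt_gaussianPDFReal_mul (m₁ m₂ : ℝ) {v w : NNReal} (hv : v ≠ 0) (hw : w ≠ 0) (x : ℝ) :
    √(gaussianPDFReal m₁ v x * gaussianPDFReal m₂ w x) =
      √((√(2 * Real.pi * v))⁻¹ * (√(2 * Real.pi * w))⁻¹) *
        Real.exp (-((m₁ - m₂) ^ 2 / (4 * (v + w)))) *
        Real.exp (-((v + w) / (4 * (v * w))) * (x - (m₁ * w + m₂ * v) / (v + w)) ^ 2) := by
  rw [gaussianPDFReal, gaussianPDFReal, mul_mul_mul_comm, Real.sqrt_mul (by positivity),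
    mul_assoc (√_), ← Real.exp_add, ← Real.exp_add, ← Real.exp_half]
  congr 2
  field_simp
  ring

lemma sqrt_gaussian_normalization {v w : ℝ} (hv : 0 < v) (hw : 0 < w) :
    √((√(2 * Real.pi * v))⁻¹ * (√(2 * Real.pi * w))⁻¹) *
      √(Real.pi / ((v + w) / (4 * (v * w)))) = gaussianAffinity v w := by
  refine (pow_left_inj₀ (by positivity) (gaussianAffinity_pos hv hw).le four_ne_zero).1 ?_
  have sqrt_pow_four : ∀ {a : ℝ}, 0 ≤ a → √a ^ 4 = a ^ 2 := fun {a} ha => by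
    rw [show 4 = 2 * 2 from rfl, pow_mul, Real.sq_sqrt ha]
  rw [gaussianAffinity_pow_four hv.le hw.le, mul_pow, sqrt_pow_four (by positivity),
    sqrt_pow_four (by positivity), mul_pow, inv_pow, inv_pow, Real.sq_sqrt (by positivity),
    Real.sq_sqrt (by positivity)]
  field_simp
  norm_num

lemma hellingerAffinity_gaussianPDFReal (m₁ m₂ : ℝ) {v w : NNReal} (hv : v ≠ 0) (hw : w ≠ 0) :
    hellingerAffinity volume (gaussianPDFReal m₁ v) (gaussianPDFReal m₂ w) =
      gaussianAffinity v w * Real.exp (-((m₁ - m₂) ^ 2 / (4 * (v + w)))) := by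
  simp only [hellingerAffinity, sqrt_gaussianPDFReal_mul m₁ m₂ hv hw]
  rw [integral_const_mul, integral_sub_right_eq_self fun x =>
      Real.exp (-((v + w : ℝ) / (4 * (v * w))) * x ^ 2), integral_gaussian, mul_right_comm,
    sqrt_gaussian_normalization (by positivity) (by positivity)]

variable {ι : Type*} [Fintype ι]

lemma sq_tvDist_pi_gaussianReal_le (m m' : ι → ℝ) {v w : ι → NNReal} (hv : ∀ i, v i ≠ 0)
    (hw : ∀ i, w i ≠ 0) :
    tvDist (Measure.pi fun i => gaussianReal (m i) (v i))
      (Measure.pi fun i => gaussianReal (m' i) (w i)) ^ 2 ≤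
      1 - (∏ i, gaussianAffinity (v i) (w i) *
        Real.exp (-((m i - m' i) ^ 2 / (4 * (v i + w i))))) ^ 2 := by
  have density : ∀ (m : ι → ℝ) (v : ι → NNReal), (∀ i, v i ≠ 0) → ∀ i,
      gaussianReal (m i) (v i) =
        volume.withDensity fun x => ENNReal.ofReal (gaussianPDFReal (m i) (v i) x) :=
    fun m v hv i => gaussianReal_of_var_ne_zero _ (hv i)
  have isProbability : ∀ (m : ι → ℝ) (v : ι → NNReal), (∀ i, v i ≠ 0) → ∀ i,
      IsProbabilityMeasure
        (volume.withDensity fun x => ENNReal.ofReal (gaussianPDFReal (m i) (v i) x)) :=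
    fun m v hv i => density m v hv i ▸ inferInstance
  have := isProbability m v hv
  have := isProbability m' w hw
  simp only [density m v hv, density m' w hw,
    ← hellingerAffinity_gaussianPDFReal _ _ (hv _) (hw _)]
  exact sq_tvDist_pi_withDensity_le _ (fun i => integrable_gaussianPDFReal _ _)
    (fun i => integrable_gaussianPDFReal _ _) (fun i => gaussianPDFReal_nonneg _ _)
    fun i => gaussianPDFReal_nonneg _ _

variable [DecidableEq ι]

lemma covGap_diagonal {v w : ι → ℝ} (hv : ∀ i, 0 < v i) (hw : ∀ i, 0 < w i) :
    covGap (Matrix.diagonal v) (Matrix.diagonal w) =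
      ∑ i, -Real.log (gaussianAffinity (v i) (w i)) := by
  have average : (1 / 2 : ℝ) • (Matrix.diagonal v + Matrix.diagonal w) =
      Matrix.diagonal fun i => (v i + w i) / 2 := by
    rw [Matrix.diagonal_add, ← Matrix.diagonal_smul]
    congr 1 with i
    exact one_div_mul_eq_div _ _
  have average_nonneg : ∀ i, 0 ≤ (v i + w i) / 2 := fun i =>
    (half_pos (add_pos (hv i) (hw i))).le
  rw [covGap, average, Matrix.det_diagonal, Matrix.det_diagonal, Matrix.det_diagonal,
    ← Real.finsetProd_rpow _ _ fun i _ => (hv i).le,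
    ← Real.finsetProd_rpow _ _ fun i _ => (hw i).le,
    ← Real.finsetProd_rpow _ _ fun i _ => average_nonneg i, ← Finset.prod_mul_distrib,
    ← Finset.prod_div_distrib, Finset.sum_neg_distrib,
    ← Real.log_prod fun i _ => (gaussianAffinity_pos (hv i) (hw i)).ne']
  rfl

lemma covGap_diagonal_nonneg {v w : ι → ℝ} (hv : ∀ i, 0 < v i) (hw : ∀ i, 0 < w i) :
    0 ≤ covGap (Matrix.diagonal v) (Matrix.diagonal w) := by
  rw [covGap_diagonal hv hw]
  exact Finset.sum_nonneg fun i _ => neg_nonneg.2 <|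
    Real.log_nonpos (gaussianAffinity_pos (hv i) (hw i)).le (gaussianAffinity_le_one (hv i) (hw i))

lemma covGap_diagonal_le {v w : ι → ℝ} (hv : ∀ i, 0 < v i) (hw : ∀ i, 0 < w i) :
    covGap (Matrix.diagonal v) (Matrix.diagonal w) ≤
      ∑ i, (v i - w i) ^ 2 / (16 * (v i * w i)) := by
  rw [covGap_diagonal hv hw]
  exact Finset.sum_le_sum fun i _ => neg_log_gaussianAffinity_le (hv i) (hw i)

lemma multivariateGaussian_diagonal (m : EuclideanSpace ℝ ι) {v : ι → ℝ} (hv : ∀ i, 0 ≤ v i) :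
    multivariateGaussian m (Matrix.diagonal v) =
      (Measure.pi fun i => gaussianReal (m i) (v i).toNNReal).map (WithLp.toLp 2) := by
  refine Measure.ext_of_charFun (E := EuclideanSpace ℝ ι) <| funext fun t => ?_
  rw [charFun_multivariateGaussian (Matrix.PosSemidef.diagonal hv), charFun_pi]
  simp_rw [charFun_gaussianReal, ← Complex.exp_sum, PiLp.inner_apply]
  simp only [RCLike.inner_apply, conj_trivial, dotProduct, Matrix.mulVec_diagonal,
    Finset.sum_sub_distrib, Complex.ofReal_sum, Complex.ofReal_mul, Finset.sum_mul,
    Finset.sum_div, Real.coe_toNNReal _ (hv _)]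
  congr! 3 <;> ring

lemma sq_tvDist_multivariateGaussian_le (m m' : EuclideanSpace ℝ ι) {v w : ι → ℝ}
    (hv : ∀ i, 0 < v i) (hw : ∀ i, 0 < w i) :
    tvDist (multivariateGaussian m (Matrix.diagonal v))
      (multivariateGaussian m' (Matrix.diagonal w)) ^ 2 ≤
      2 * (1 - Real.exp (-(covGap (Matrix.diagonal v) (Matrix.diagonal w) +
        ∑ i, (m i - m' i) ^ 2 / (4 * (v i + w i))))) := by
  rw [multivariateGaussian_diagonal m fun i => (hv i).le,
    multivariateGaussian_diagonal m' fun i => (hw i).le]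
  have affinity : ∏ i, gaussianAffinity (v i).toNNReal (w i).toNNReal *
      Real.exp (-((m i - m' i) ^ 2 / (4 * ((v i).toNNReal + (w i).toNNReal)))) =
      Real.exp (-(covGap (Matrix.diagonal v) (Matrix.diagonal w) +
        ∑ i, (m i - m' i) ^ 2 / (4 * (v i + w i)))) := by
    rw [covGap_diagonal hv hw, ← Finset.sum_add_distrib, ← Finset.sum_neg_distrib, Real.exp_sum]
    refine Finset.prod_congr rfl fun i _ => ?_
    rw [neg_add, neg_neg, Real.exp_add, Real.exp_log (gaussianAffinity_pos (hv i) (hw i)),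
      Real.coe_toNNReal _ (hv i).le, Real.coe_toNNReal _ (hw i).le]
  have sq_le := sq_tvDist_pi_gaussianReal_le m m' (fun i => (Real.toNNReal_pos.2 (hv i)).ne')
    fun i => (Real.toNNReal_pos.2 (hw i)).ne'
  rw [affinity] at sq_le
  calc _ ≤ _ := pow_le_pow_left₀ (tvDist_nonneg _ _) (tvDist_map_le _ _ (by fun_prop)) 2
    _ ≤ _ := sq_le
    _ ≤ _ := by nlinarith [sq_nonneg (1 - Real.exp (-(covGap (Matrix.diagonal v)
      (Matrix.diagonal w) + ∑ i, (m i - m' i) ^ 2 / (4 * (v i + w i)))))]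

end GaussianAffinity

section HalfSpace

section Reflection

variable {P Q : Measure ℝ} {p q : ℝ}

lemma measureReal_Iic_sub_eq_Ici_add (hQ : Q.map (fun x => 2 * q - x) = Q) (r : ℝ) :
    Q.real (Set.Iic (q - r)) = Q.real (Set.Ici (q + r)) := by
  conv_lhs => rw [← hQ, map_measureReal_apply (by fun_prop) measurableSet_Iic]
  congr 1
  ext x
  simp only [Set.mem_preimage, Set.mem_Iic, Set.mem_Ici]
  constructor <;> intro h <;> linarith

variable [IsProbabilityMeasure P] [IsProbabilityMeasure Q]

lemma one_half_le_measureReal_Ici (hP : P.map (fun x => 2 * p - x) = P) :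
    1 / 2 ≤ P.real (Set.Ici p) := by
  have symm := measureReal_Iic_sub_eq_Ici_add hP 0
  have cover := measureReal_union_le (μ := P) (Set.Iic p) (Set.Ici p)
  rw [Set.Iic_union_Ici, probReal_univ] at cover
  rw [sub_zero, add_zero] at symm
  linarith

lemma measureReal_ball_le_one_sub (hQ : Q.map (fun x => 2 * q - x) = Q) {r : ℝ} (hr : 0 < r) :
    Q.real (Metric.ball q r) ≤ 1 - 2 * Q.real (Set.Ici (q + r)) := by
  have tails : Disjoint (Set.Iic (q - r)) (Set.Ici (q + r)) :=
    Set.Iic_disjoint_Ici.2 (by linarith)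
  calc Q.real (Metric.ball q r)
      ≤ Q.real (Set.Iic (q - r) ∪ Set.Ici (q + r))ᶜ := measureReal_mono fun x hx => by
        rw [Real.ball_eq_Ioo] at hx
        simpa using hx
    _ = 1 - 2 * Q.real (Set.Ici (q + r)) := by
        rw [probReal_compl_eq_one_sub (measurableSet_Iic.union measurableSet_Ici),
          measureReal_union tails measurableSet_Ici, measureReal_Iic_sub_eq_Ici_add hQ, two_mul]

lemma half_measureReal_ball_le_tvDist (hP : P.map (fun x => 2 * p - x) = P)
    (hQ : Q.map (fun x => 2 * q - x) = Q) (hqp : q < p) :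
    Q.real (Metric.ball q (p - q)) / 2 ≤ tvDist P Q := by
  have upper := one_half_le_measureReal_Ici hP
  have lower := measureReal_ball_le_one_sub hQ (sub_pos.2 hqp)
  rw [add_sub_cancel] at lower
  linarith [measureReal_sub_le_tvDist P Q (measurableSet_Ici (a := p))]

end Reflection

lemma le_measureReal_gaussianReal_ball (m : ℝ) {v : NNReal} (hv : v ≠ 0) {r : ℝ} (hr : 0 ≤ r) :
    2 * gaussianPDFReal 0 1 1 * min 1 (r / √v) ≤ (gaussianReal m v).real (Metric.ball m r) := by
  have sqrt_pos : 0 < √(v : ℝ) := by positivity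
  have density_le : ∀ x ∈ Metric.ball m (min √v r),
      gaussianPDFReal 0 1 1 / √v ≤ gaussianPDFReal m v x := fun x hx => by
    have dist_sq_le : (x - m) ^ 2 ≤ v := by
      rw [← sq_abs, ← Real.dist_eq, ← Real.le_sqrt dist_nonneg v.coe_nonneg]
      exact hx.le.trans (min_le_left _ _)
    rw [gaussianPDFReal, gaussianPDFReal, Real.sqrt_mul (by positivity) (v : ℝ), mul_inv,
      mul_div_right_comm]
    simp only [NNReal.coe_one, mul_one, sub_zero, one_pow, ← div_eq_mul_inv]
    gcongr ?_ * Real.exp ?_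
    rw [div_le_div_iff₀ (by positivity) (by positivity)]
    linarith
  calc 2 * gaussianPDFReal 0 1 1 * min 1 (r / √v)
      = gaussianPDFReal 0 1 1 / √v * volume.real (Metric.ball m (min √v r)) := by
        rw [Real.volume_real_ball (le_min sqrt_pos.le hr),
          show min 1 (r / √v) = min √v r / √v by
            rw [← min_div_div_right sqrt_pos.le, div_self sqrt_pos.ne']]
        ring
    _ ≤ ∫ x in Metric.ball m (min √v r), gaussianPDFReal m v x :=
        setIntegral_ge_of_const_le_real Metric.isOpen_ball.measurableSet (by finiteness)
          density_le (integrable_gaussianPDFReal m v).integrableOn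
    _ = (gaussianReal m v).real (Metric.ball m (min √v r)) := by
        rw [Measure.real, gaussianReal_apply_eq_integral m hv,
          ENNReal.toReal_ofReal (integral_nonneg (gaussianPDFReal_nonneg m v))]
    _ ≤ (gaussianReal m v).real (Metric.ball m r) :=
        measureReal_mono (Metric.ball_subset_ball (min_le_right _ _))

lemma le_tvDist_gaussianReal {m m' : ℝ} (hm : m' < m) (v : NNReal) {w : NNReal} (hw : w ≠ 0) :
    gaussianPDFReal 0 1 1 * min 1 ((m - m') / √w) ≤
      tvDist (gaussianReal m v) (gaussianReal m' w) := by
  have reflection : ∀ (m : ℝ) (v : NNReal),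
      (gaussianReal m v).map (fun x => 2 * m - x) = gaussianReal m v := fun m v => by
    rw [gaussianReal_map_const_sub, two_mul, add_sub_cancel_right]
  linarith [half_measureReal_ball_le_tvDist (reflection m v) (reflection m' w) hm,
    le_measureReal_gaussianReal_ball m' hw (sub_nonneg.2 hm.le)]

variable {ι : Type*} [Fintype ι] [DecidableEq ι]

lemma map_inner_multivariateGaussian (m t : EuclideanSpace ℝ ι) {S : Matrix ι ι ℝ}
    (hS : S.PosSemidef) :
    (multivariateGaussian m S).map (fun x => inner ℝ t x) =
      gaussianReal (inner ℝ t m) (t.ofLp ⬝ᵥ S.mulVec t.ofLp).toNNReal := by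
  have mean := (innerSL ℝ t).integral_comp_id_comm
    (IsGaussian.integrable_id (μ := multivariateGaussian m S))
  have variance := covarianceBilin_self (IsGaussian.memLp_two_id (μ := multivariateGaussian m S)) t
  have law := IsGaussian.map_eq_gaussianReal (μ := multivariateGaussian m S) (innerSL ℝ t)
  rw [integral_id_multivariateGaussian] at mean
  rw [covarianceBilin_multivariateGaussian hS] at variance
  rw [mean] at law
  rw [variance]
  exact law

-- The test is the half-space orthogonal to `m - m'` through `m`.
lemma le_tvDist_multivariateGaussian (m m' : EuclideanSpace ℝ ι) {S S' : Matrix ι ι ℝ} {b : ℝ}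
    (hS : S.PosSemidef) (hS' : S'.PosDef)
    (hb : (m - m').ofLp ⬝ᵥ S'.mulVec (m - m').ofLp ≤ b * ‖m - m'‖ ^ 2) :
    gaussianPDFReal 0 1 1 * min 1 (‖m - m'‖ / √b) ≤
      tvDist (multivariateGaussian m S) (multivariateGaussian m' S') := by
  set t := m - m'
  obtain h0 | h0 := eq_or_ne t 0
  · simpa [h0] using tvDist_nonneg _ _
  have norm_pos : 0 < ‖t‖ := norm_pos_iff.2 h0
  have mean_sub : inner ℝ t m - inner ℝ t m' = ‖t‖ ^ 2 := by
    rw [← inner_sub_right, real_inner_self_eq_norm_sq]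
  set w := t.ofLp ⬝ᵥ S'.mulVec t.ofLp
  have w_pos : 0 < w := by
    simpa using hS'.dotProduct_mulVec_pos ((WithLp.ofLp_eq_zero 2).ne.2 h0)
  have sqrt_le : √w ≤ √b * ‖t‖ := by
    rw [← Real.sqrt_sq norm_pos.le, ← Real.sqrt_mul' _ (sq_nonneg _)]
    exact Real.sqrt_le_sqrt hb
  have sqrt_pos : 0 < √b :=
    pos_of_mul_pos_left ((Real.sqrt_pos.2 w_pos).trans_le sqrt_le) norm_pos.le
  calc gaussianPDFReal 0 1 1 * min 1 (‖t‖ / √b)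
      ≤ gaussianPDFReal 0 1 1 * min 1 ((inner ℝ t m - inner ℝ t m') / √w.toNNReal) := by
        rw [mean_sub, Real.coe_toNNReal _ w_pos.le]
        gcongr _ * min 1 ?_
        · exact gaussianPDFReal_nonneg _ _ _
        · rw [div_le_div_iff₀ sqrt_pos (Real.sqrt_pos.2 w_pos)]
          nlinarith
    _ ≤ _ := le_tvDist_gaussianReal (by linarith [pow_pos norm_pos 2]) _
        (Real.toNNReal_pos.2 w_pos).ne'
    _ = tvDist ((multivariateGaussian m S).map fun x => inner ℝ t x)
          ((multivariateGaussian m' S').map fun x => inner ℝ t x) := by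
        rw [map_inner_multivariateGaussian m t hS,
          map_inner_multivariateGaussian m' t hS'.posSemidef]
    _ ≤ _ := tvDist_map_le _ _ (by fun_prop)

end HalfSpace

section HellingerExponent

/-- The exponent `f` for which `√2 * √(1 - exp (-f))`, the Hellinger bound at affinity `exp (-f)`,
equals `T`. Meaningful only for `T ^ 2 < 2`. -/
noncomputable def hellingerExponent (T : ℝ) : ℝ :=
  -Real.log (1 - T ^ 2 / 2)

variable {T : ℝ}

lemma sqrt_two_mul_sqrt_one_sub_exp_neg_hellingerExponent (hT : T ∈ Set.Icc 0 1) :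
    √2 * √(1 - Real.exp (-hellingerExponent T)) = T := by
  rw [hellingerExponent, neg_neg, Real.exp_log (by nlinarith [hT.1, hT.2]),
    ← Real.sqrt_mul zero_le_two, sub_sub_cancel, mul_div_cancel₀ _ two_ne_zero,
    Real.sqrt_sq hT.1]

lemma sq_div_two_le_hellingerExponent (hT : T ^ 2 < 2) : T ^ 2 / 2 ≤ hellingerExponent T := by
  have log_le := Real.log_le_sub_one_of_pos (show 0 < 1 - T ^ 2 / 2 by linarith)
  rw [hellingerExponent]
  linarith

lemma hellingerExponent_le_of_sq_le {g : ℝ} (h : T ^ 2 ≤ 2 * (1 - Real.exp (-g))) :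
    hellingerExponent T ≤ g := by
  have exp_le : Real.exp (-g) ≤ 1 - T ^ 2 / 2 := by linarith
  rwa [hellingerExponent, neg_le, Real.le_log_iff_exp_le ((Real.exp_pos _).trans_le exp_le)]

lemma hellingerExponent_le_one (hT : T ∈ Set.Icc 0 1) : hellingerExponent T ≤ 1 :=
  hellingerExponent_le_of_sq_le <| by
    have exp_le : Real.exp (-1) ≤ 1 / 2 := Real.exp_neg_one_lt_half.le
    nlinarith [hT.1, hT.2]

end HellingerExponent

section Sparsification

lemma sq_min_one {x : ℝ} (hx : 0 ≤ x) : min 1 x ^ 2 = min 1 (x ^ 2) := by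
  obtain h | h := le_total 1 x
  · rw [min_eq_left h, min_eq_left (one_le_pow₀ h), one_pow]
  · rw [min_eq_right h, min_eq_right (pow_le_one₀ hx h)]

lemma min_one_mul_min_one_le {x y : ℝ} (hx : 0 ≤ x) (hy : 0 ≤ y) :
    min 1 x * min 1 y ≤ min 1 (x * y) :=
  le_min (mul_le_one₀ (min_le_left _ _) (le_min zero_le_one hy) (min_le_left _ _))
    (mul_le_mul (min_le_right _ _) (min_le_right _ _) (le_min zero_le_one hy) hx)

variable {q r : ℕ}

lemma blockCov_eq_diagonal (v : Fin q → ℝ) (w : Fin r → ℝ) :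
    blockCov v w = Matrix.diagonal (Sum.elim v w) :=
  Matrix.fromBlocks_diagonal v w

instance isProbabilityMeasure_blockGaussian (μ₁ : EuclideanSpace ℝ (Fin q))
    (μ₂ : EuclideanSpace ℝ (Fin r)) (v : Fin q → ℝ) (w : Fin r → ℝ) :
    IsProbabilityMeasure (blockGaussian μ₁ μ₂ v w) :=
  inferInstanceAs (IsProbabilityMeasure (multivariateGaussian _ _))

lemma norm_toLp_elim_sub_toLp_elim (μu : EuclideanSpace ℝ (Fin q))
    (μo μg : EuclideanSpace ℝ (Fin r)) :
    ‖(WithLp.toLp 2 (Sum.elim μu μo) - WithLp.toLp 2 (Sum.elim μu μg) :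
      EuclideanSpace ℝ (Fin q ⊕ Fin r))‖ = ‖μo - μg‖ := by
  simp [EuclideanSpace.norm_eq]

variable (μu : EuclideanSpace ℝ (Fin q)) (μo μg : EuclideanSpace ℝ (Fin r)) {su : Fin q → ℝ}
  {so sg : Fin r → ℝ}

lemma le_tvDist_blockGaussian {b : ℝ} (hu : ∀ i, 0 < su i) (ho : ∀ i, 0 ≤ so i)
    (hg : ∀ i, sg i ∈ Set.Ioc 0 b) :
    gaussianPDFReal 0 1 1 * min 1 (‖μo - μg‖ / √b) ≤
      tvDist (blockGaussian μu μo su so) (blockGaussian μu μg su sg) := by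
  rw [blockGaussian, blockGaussian, blockCov_eq_diagonal, blockCov_eq_diagonal,
    ← norm_toLp_elim_sub_toLp_elim μu]
  refine le_tvDist_multivariateGaussian _ _
    (.diagonal <| Sum.forall.2 ⟨fun i => (hu i).le, ho⟩)
    (.diagonal <| Sum.forall.2 ⟨hu, fun i => (hg i).1⟩) ?_
  rw [norm_toLp_elim_sub_toLp_elim, EuclideanSpace.real_norm_sq_eq, Finset.mul_sum]
  simp only [dotProduct, Matrix.mulVec_diagonal, Fintype.sum_sum_type, PiLp.sub_apply,
    Sum.elim_inl, Sum.elim_inr, sub_self, zero_mul, Finset.sum_const_zero, zero_add]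
  exact Finset.sum_le_sum fun i _ => by
    rw [mul_left_comm, ← sq]
    exact mul_le_mul_of_nonneg_right (hg i).2 (sq_nonneg _)

lemma sq_tvDist_blockGaussian_le {a : ℝ} (ha : 0 < a) (hu : ∀ i, 0 < su i)
    (ho : ∀ i, a ≤ so i) (hg : ∀ i, a ≤ sg i) :
    tvDist (blockGaussian μu μo su so) (blockGaussian μu μg su sg) ^ 2 ≤
      2 * (1 - Real.exp (-(covGap (blockCov su so) (blockCov su sg) +
        1 / (8 * a) * ‖μo - μg‖ ^ 2))) := by
  simp only [blockGaussian, blockCov_eq_diagonal]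
  refine (sq_tvDist_multivariateGaussian_le _ _
    (Sum.forall.2 ⟨hu, fun i => ha.trans_le (ho i)⟩)
    (Sum.forall.2 ⟨hu, fun i => ha.trans_le (hg i)⟩)).trans ?_
  gcongr
  rw [EuclideanSpace.real_norm_sq_eq, Finset.mul_sum]
  simp only [Fintype.sum_sum_type, PiLp.sub_apply, Sum.elim_inl, Sum.elim_inr, sub_self,
    zero_pow two_ne_zero, zero_div, Finset.sum_const_zero, zero_add]
  refine Finset.sum_le_sum fun i _ => ?_
  rw [one_div_mul_eq_div]
  exact div_le_div_of_nonneg_left (sq_nonneg _) (by positivity) (by linarith [ho i, hg i])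

lemma covGap_blockCov_nonneg (hu : ∀ i, 0 < su i) (ho : ∀ i, 0 < so i) (hg : ∀ i, 0 < sg i) :
    0 ≤ covGap (blockCov su so) (blockCov su sg) := by
  rw [blockCov_eq_diagonal, blockCov_eq_diagonal]
  exact covGap_diagonal_nonneg (Sum.forall.2 ⟨hu, ho⟩) (Sum.forall.2 ⟨hu, hg⟩)

lemma tvDist_blockGaussian_mem_Icc :
    tvDist (blockGaussian μu μo su so) (blockGaussian μu μg su sg) ∈ Set.Icc 0 1 :=
  ⟨tvDist_nonneg _ _, tvDist_le_one _ _⟩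

lemma le_hellingerExponent_blockGaussian {b : ℝ} (hb : 0 < b) (hu : ∀ i, 0 < su i)
    (ho : ∀ i, 0 ≤ so i) (hg : ∀ i, sg i ∈ Set.Ioc 0 b) :
    gaussianPDFReal 0 1 1 ^ 2 / 2 * min 1 (1 / b) * min 1 (‖μo - μg‖ ^ 2) ≤
      hellingerExponent (tvDist (blockGaussian μu μo su so) (blockGaussian μu μg su sg)) := by
  have tv_mem := tvDist_blockGaussian_mem_Icc μu μo μg (su := su) (so := so) (sg := sg)
  have le_tv := le_tvDist_blockGaussian μu μo μg hu ho hg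
  set T := tvDist (blockGaussian μu μo su so) (blockGaussian μu μg su sg)
  calc gaussianPDFReal 0 1 1 ^ 2 / 2 * min 1 (1 / b) * min 1 (‖μo - μg‖ ^ 2)
      = gaussianPDFReal 0 1 1 ^ 2 / 2 * (min 1 (1 / b) * min 1 (‖μo - μg‖ ^ 2)) := mul_assoc _ _ _
    _ ≤ gaussianPDFReal 0 1 1 ^ 2 / 2 * min 1 (‖μo - μg‖ / √b) ^ 2 := by
        rw [sq_min_one (by positivity), div_pow, Real.sq_sqrt hb.le]
        refine mul_le_mul_of_nonneg_left ?_ (by positivity)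
        refine (min_one_mul_min_one_le (by positivity) (sq_nonneg _)).trans_eq ?_
        rw [one_div_mul_eq_div]
    _ = (gaussianPDFReal 0 1 1 * min 1 (‖μo - μg‖ / √b)) ^ 2 / 2 := by ring
    _ ≤ T ^ 2 / 2 := by
        gcongr
        exact mul_nonneg (gaussianPDFReal_nonneg _ _ _) (le_min zero_le_one (by positivity))
    _ ≤ hellingerExponent T := sq_div_two_le_hellingerExponent (by nlinarith [tv_mem.1, tv_mem.2])

lemma hellingerExponent_blockGaussian_le_add_sq {a : ℝ} (ha : 0 < a) (hu : ∀ i, 0 < su i)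
    (ho : ∀ i, a ≤ so i) (hg : ∀ i, a ≤ sg i) :
    hellingerExponent (tvDist (blockGaussian μu μo su so) (blockGaussian μu μg su sg)) ≤
      covGap (blockCov su so) (blockCov su sg) + (1 / (8 * a) + 1) * ‖μo - μg‖ ^ 2 := by
  have sq_le := hellingerExponent_le_of_sq_le (sq_tvDist_blockGaussian_le μu μo μg ha hu ho hg)
  linarith [sq_nonneg ‖μo - μg‖]

lemma hellingerExponent_blockGaussian_le_add_norm {a : ℝ} (ha : 0 < a) (hu : ∀ i, 0 < su i)
    (ho : ∀ i, a ≤ so i) (hg : ∀ i, a ≤ sg i) :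
    hellingerExponent (tvDist (blockGaussian μu μo su so) (blockGaussian μu μg su sg)) ≤
      covGap (blockCov su so) (blockCov su sg) + (1 / (8 * a) + 1) * ‖μo - μg‖ := by
  have gap_nonneg := covGap_blockCov_nonneg hu (fun i => ha.trans_le (ho i))
    fun i => ha.trans_le (hg i)
  have scale_nonneg : 0 ≤ 1 / (8 * a) := by positivity
  obtain norm_le | norm_ge := le_total ‖μo - μg‖ 1
  · refine (hellingerExponent_blockGaussian_le_add_sq μu μo μg ha hu ho hg).trans ?_
    gcongr
    exact pow_le_of_le_one (norm_nonneg _) norm_le two_ne_zero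
  · refine (hellingerExponent_le_one (tvDist_blockGaussian_mem_Icc μu μo μg)).trans ?_
    nlinarith

end Sparsification

section Dilation

variable {ν : Measure ℝ} [IsProbabilityMeasure ν] {ρ : ℝ}

lemma measureReal_Iic_mul_sub_le_tvDist (hρ : 0 < ρ) (l : ℝ) :
    ν.real (Set.Iic (l * ρ)) - ν.real (Set.Iic l) ≤ tvDist ν (ν.map (ρ * ·)) := by
  have := Measure.isProbabilityMeasure_map (μ := ν) (measurable_const_mul ρ).aemeasurable
  have preimage : (ρ * ·) ⁻¹' Set.Iic (l * ρ) = Set.Iic l := by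
    rw [Set.preimage_const_mul_Iic₀ _ hρ, mul_div_cancel_right₀ _ hρ.ne']
  rw [← preimage, ← map_measureReal_apply (measurable_const_mul ρ) measurableSet_Iic]
  exact measureReal_sub_le_tvDist _ _ measurableSet_Iic

lemma measureReal_Iic_mul_pow_sub_le_mul_tvDist (hρ : 0 < ρ) (l : ℝ) (n : ℕ) :
    ν.real (Set.Iic (l * ρ ^ n)) - ν.real (Set.Iic l) ≤ n * tvDist ν (ν.map (ρ * ·)) := by
  induction n with
  | zero => simp
  | succ n ih =>
    have last := measureReal_Iic_mul_sub_le_tvDist (ν := ν) hρ (l * ρ ^ n)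
    rw [mul_assoc, ← pow_succ] at last
    push_cast
    linarith

-- About `w / log ρ` dilations by `ρ` carry `l` past `l * exp w`.
lemma measureReal_Ioc_mul_log_le_tvDist {l w : ℝ} (hl : 0 ≤ l) (hw : 0 ≤ w) (hρ : 1 < ρ) :
    ν.real (Set.Ioc l (l * Real.exp w)) * Real.log ρ ≤
      (w + Real.log ρ) * tvDist ν (ν.map (ρ * ·)) := by
  have ρ_pos : 0 < ρ := one_pos.trans hρ
  have log_pos : 0 < Real.log ρ := Real.log_pos hρ
  set N := ⌈w / Real.log ρ⌉₊
  have exp_le_pow : Real.exp w ≤ ρ ^ N := by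
    rw [← Real.le_log_iff_exp_le (by positivity), Real.log_pow, ← div_le_iff₀ log_pos]
    exact Nat.le_ceil _
  have ceil_le : N * Real.log ρ ≤ w + Real.log ρ := by
    have ceil_lt := Nat.ceil_lt_add_one (show 0 ≤ w / Real.log ρ by positivity)
    calc N * Real.log ρ ≤ (w / Real.log ρ + 1) * Real.log ρ := by gcongr
      _ = w + Real.log ρ := by field_simp
  have Ioc_le : ν.real (Set.Ioc l (l * Real.exp w)) ≤ N * tvDist ν (ν.map (ρ * ·)) := by
    rw [← Set.Iic_sdiff_Iic, measureReal_sdiff (Set.Iic_subset_Iic.2 <|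
      le_mul_of_one_le_right hl (Real.one_le_exp hw)) measurableSet_Iic]
    have Iic_le := measureReal_mono (μ := ν) <|
      Set.Iic_subset_Iic.2 (mul_le_mul_of_nonneg_left exp_le_pow hl)
    linarith [measureReal_Iic_mul_pow_sub_le_mul_tvDist (ν := ν) ρ_pos l N]
  calc ν.real (Set.Ioc l (l * Real.exp w)) * Real.log ρ
      ≤ N * tvDist ν (ν.map (ρ * ·)) * Real.log ρ := by gcongr
    _ = N * Real.log ρ * tvDist ν (ν.map (ρ * ·)) := mul_right_comm _ _ _
    _ ≤ _ := mul_le_mul_of_nonneg_right ceil_le (tvDist_nonneg _ _)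

end Dilation

section Cantelli

variable {Ω : Type*} [MeasurableSpace Ω] {μ : Measure Ω} [IsProbabilityMeasure μ] {X : Ω → ℝ}

lemma integral_sub_sq (hX : MemLp X 2 μ) (a : ℝ) :
    ∫ ω, (X ω - a) ^ 2 ∂μ = Var[X; μ] + (μ[X] - a) ^ 2 := by
  have variance_sub := variance_eq_sub (hX.sub (memLp_const a))
  rw [show X - (fun _ => a) = fun ω => X ω - a from rfl,
    variance_sub_const hX.aestronglyMeasurable] at variance_sub
  simp only [Pi.pow_apply] at variance_sub
  rw [integral_sub (hX.integrable one_le_two) (integrable_const a)] at variance_sub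
  simp only [integral_const, probReal_univ, one_smul] at variance_sub
  linarith

lemma sq_mul_measureReal_le_sub_le (hX : MemLp X 2 μ) (a : ℝ) {t : ℝ} (ht : 0 ≤ t) :
    t ^ 2 * μ.real {ω | X ω ≤ a - t} ≤ Var[X; μ] + (μ[X] - a) ^ 2 := by
  rw [← integral_sub_sq hX]
  have nonneg : 0 ≤ᵐ[μ] fun ω => (X ω - a) ^ 2 := .of_forall fun _ => sq_nonneg _
  refine le_trans (mul_le_mul_of_nonneg_left (measureReal_mono fun ω hω => ?_) (sq_nonneg _))
    (mul_meas_ge_le_integral_of_nonneg nonneg (hX.sub (memLp_const a)).integrable_sq (t ^ 2))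
  rw [Set.mem_ofPred_eq] at hω ⊢
  rw [← neg_sq (X ω - a)]
  exact pow_le_pow_left₀ ht (by linarith) 2

-- Cantelli's inequality: `V / c` is the shift of the second moment that gives the best bound.
lemma measureReal_le_sub_le_div (hX : MemLp X 2 μ) {V c : ℝ} (hVar : Var[X; μ] = V) (hc : 0 < c) :
    μ.real {ω | X ω ≤ μ[X] - c} ≤ V / (V + c ^ 2) := by
  have V_nonneg : 0 ≤ V := hVar ▸ variance_nonneg X μ
  have markov := sq_mul_measureReal_le_sub_le hX (μ[X] + V / c) (t := c + V / c) (by positivity)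
  rw [show μ[X] + V / c - (c + V / c) = μ[X] - c by ring, sub_add_cancel_left, neg_sq, hVar,
    ← le_div_iff₀' (by positivity)] at markov
  refine markov.trans_eq ?_
  have : V + c ^ 2 ≠ 0 := by positivity
  field_simp
  ring

lemma measureReal_add_le_le_div (hX : MemLp X 2 μ) {V c : ℝ} (hVar : Var[X; μ] = V) (hc : 0 < c) :
    μ.real {ω | μ[X] + c ≤ X ω} ≤ V / (V + c ^ 2) := by
  have lower := measureReal_le_sub_le_div hX.neg (variance_neg.trans hVar) hc
  convert lower using 3
  ext ω
  simp only [Pi.neg_apply, integral_neg]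
  constructor <;> intro h <;> linarith

lemma one_div_le_measureReal_mem_Ioc (hX : MemLp X 2 μ) {V r : ℝ} (hV : 0 ≤ V) (hr : 0 < r)
    (hVar : Var[X; μ] = V * r ^ 2) :
    1 / (2 * (4 * V + 1)) ≤
      μ.real (X ⁻¹' Set.Ioc (μ[X] - r / 2) (μ[X] + (4 * V + 1) * r)) := by
  set A := {ω | X ω ≤ μ[X] - r / 2}
  set B := {ω | μ[X] + (4 * V + 1) * r ≤ X ω}
  set I := X ⁻¹' Set.Ioc (μ[X] - r / 2) (μ[X] + (4 * V + 1) * r)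
  have lower : μ.real A ≤ 1 - 1 / (4 * V + 1) := by
    refine (measureReal_le_sub_le_div hX hVar (half_pos hr)).trans_eq ?_
    field_simp
    ring
  have upper : μ.real B ≤ 1 / (2 * (4 * V + 1)) := by
    refine (measureReal_add_le_le_div hX hVar (by positivity)).trans ?_
    rw [div_le_div_iff₀ (by positivity) (by positivity)]
    nlinarith [mul_nonneg hV (sq_nonneg r)]
  have cover : 1 ≤ μ.real A + μ.real B + μ.real I := by
    have univ_eq : (A ∪ B) ∪ I = Set.univ := Set.eq_univ_of_forall fun ω => by
      simp only [A, B, I, Set.mem_union, Set.mem_preimage, Set.mem_Ioc, Set.mem_ofPred_eq]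
      grind
    rw [← probReal_univ (μ := μ), ← univ_eq]
    exact (measureReal_union_le _ _).trans (by gcongr; exact measureReal_union_le _ _)
  have half : 1 / (4 * V + 1) = 2 * (1 / (2 * (4 * V + 1))) := by field_simp
  linarith

end Cantelli

section ChiSquared

/-- The `χ²` distribution with `d` degrees of freedom, as the law of `∑ i, z i ^ 2` for a standard
Gaussian vector `z` with coordinates indexed by `Fin d`. -/
noncomputable def chiSquared (d : ℕ) : Measure ℝ :=
  (Measure.pi fun _ : Fin d => gaussianReal 0 1).map fun z => ∑ i, z i ^ 2

instance isProbabilityMeasure_chiSquared (d : ℕ) : IsProbabilityMeasure (chiSquared d) :=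
  Measure.isProbabilityMeasure_map (Measurable.aemeasurable (by fun_prop))

lemma memLp_sq_gaussianReal : MemLp (fun x => x ^ 2) 2 (gaussianReal 0 1) := by
  have memLp_four : MemLp (id : ℝ → ℝ) (4 : ℕ) (gaussianReal 0 1) :=
    memLp_id_gaussianReal' _ (by simp)
  rw [memLp_two_iff_integrable_sq (by fun_prop)]
  refine (memLp_four.integrable_norm_pow (by norm_num)).congr (.of_forall fun x => ?_)
  simp only [id_eq, Real.norm_eq_abs]
  rw [← pow_mul, Even.pow_abs (by decide)]

lemma integral_sq_gaussianReal : ∫ x, x ^ 2 ∂(gaussianReal 0 1) = 1 := by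
  have variance_eq := variance_fun_id_gaussianReal (μ := 0) (v := 1)
  rw [variance_eq_integral (by fun_prop)] at variance_eq
  simpa using variance_eq

variable {d : ℕ}

lemma memLp_sq_eval_pi_gaussianReal (i : Fin d) :
    MemLp (fun z => z i ^ 2) 2 (Measure.pi fun _ : Fin d => gaussianReal 0 1) :=
  memLp_sq_gaussianReal.comp_measurePreserving
    (measurePreserving_eval (fun _ : Fin d => gaussianReal 0 1) i)

lemma integral_sum_sq_pi_gaussianReal :
    ∫ z, ∑ i, z i ^ 2 ∂(Measure.pi fun _ : Fin d => gaussianReal 0 1) = d := by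
  rw [integral_finsetSum _ fun i _ => (memLp_sq_eval_pi_gaussianReal i).integrable one_le_two]
  have integral_eval (i : Fin d) :
      ∫ z, z i ^ 2 ∂(Measure.pi fun _ : Fin d => gaussianReal 0 1) = 1 :=
    (integral_comp_eval (μ := fun _ : Fin d => gaussianReal 0 1) (f := fun x => x ^ 2)
      (by fun_prop)).trans integral_sq_gaussianReal
  simp [integral_eval]

lemma variance_sum_sq_pi_gaussianReal :
    Var[fun z => ∑ i, z i ^ 2; Measure.pi fun _ : Fin d => gaussianReal 0 1] =
      d * Var[fun x => x ^ 2; gaussianReal 0 1] := by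
  have variance_sum := variance_sum_pi (X := fun (_ : Fin d) x => x ^ 2)
    fun _ => memLp_sq_gaussianReal
  simp only [Finset.sum_const, Finset.card_univ, Fintype.card_fin, nsmul_eq_mul] at variance_sum
  rw [← variance_sum]
  congr 1
  exact (Finset.sum_fn _ _).symm

lemma sq_add_mul_le {s k : ℝ} (hs : 1 ≤ s) (hk : 0 ≤ k) :
    s ^ 2 + k * s ≤ (s ^ 2 - s / 2) * ((2 * k + 1) / s + 1) := by
  have expand : (s ^ 2 - s / 2) * ((2 * k + 1) / s + 1) =
      s ^ 2 + k * s + (k + 1 / 2) * (s - 1) := by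
    field_simp
    ring
  nlinarith

-- The standard deviation is of order `√d` around the mean `d`, hence `1 / √d` in log scale.
lemma exists_chiSquared_log_width : ∃ η L : ℝ, 0 < η ∧ 0 < L ∧ ∀ d : ℕ, 0 < d →
    ∃ l : ℝ, 0 < l ∧ η ≤ (chiSquared d).real (Set.Ioc l (l * Real.exp (L / √d))) := by
  set V := Var[fun x : ℝ => x ^ 2; gaussianReal 0 1]
  have V_nonneg : 0 ≤ V := variance_nonneg _ _
  refine ⟨1 / (2 * (4 * V + 1)), 2 * (4 * V + 1) + 1, by positivity, by positivity,
    fun d hd => ⟨d - √d / 2, ?_, ?_⟩⟩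
  all_goals
    have one_le : 1 ≤ √(d : ℝ) := Real.one_le_sqrt.2 (by exact_mod_cast hd)
    have sq_sqrt : √(d : ℝ) ^ 2 = d := Real.sq_sqrt d.cast_nonneg
  · nlinarith
  have mem_Ioc := one_div_le_measureReal_mem_Ioc (r := √d)
    (memLp_finsetSum _ fun (i : Fin d) _ => memLp_sq_eval_pi_gaussianReal i)
    V_nonneg (by positivity)
    (by rw [variance_sum_sq_pi_gaussianReal, sq_sqrt, mul_comm])
  rw [integral_sum_sq_pi_gaussianReal,
    ← map_measureReal_apply (by fun_prop) measurableSet_Ioc] at mem_Ioc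
  refine mem_Ioc.trans (measureReal_mono (Set.Ioc_subset_Ioc_right ?_))
  calc d + (4 * V + 1) * √d
      ≤ (d - √d / 2) * ((2 * (4 * V + 1) + 1) / √d + 1) := by
        simpa only [sq_sqrt] using sq_add_mul_le one_le (by positivity : 0 ≤ 4 * V + 1)
    _ ≤ (d - √d / 2) * Real.exp ((2 * (4 * V + 1) + 1) / √d) := by
        gcongr
        · nlinarith
        · exact Real.add_one_le_exp _

end ChiSquared

section Randomization

variable {d : ℕ}

lemma isoGaussian_eq_diagonal (m : EuclideanSpace ℝ (Fin d)) (s : ℝ) :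
    isoGaussian m s = multivariateGaussian m (Matrix.diagonal fun _ => s ^ 2) := by
  rw [isoGaussian, Matrix.smul_one_eq_diagonal]

instance isProbabilityMeasure_isoGaussian (m : EuclideanSpace ℝ (Fin d)) (s : ℝ) :
    IsProbabilityMeasure (isoGaussian m s) := by
  rw [isoGaussian]
  infer_instance

instance isProbabilityMeasure_randomize (σ : ℝ) (P : Measure (EuclideanSpace ℝ (Fin d)))
    [IsProbabilityMeasure P] : IsProbabilityMeasure (randomize σ P) := by
  rw [randomize]
  infer_instance

lemma randomize_isoGaussian (m : EuclideanSpace ℝ (Fin d)) (s σ : ℝ) :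
    randomize σ (isoGaussian m s) = isoGaussian m √(s ^ 2 + σ ^ 2) := by
  have posSemidef (s : ℝ) : (Matrix.diagonal fun _ : Fin d => s ^ 2).PosSemidef :=
    .diagonal fun _ => sq_nonneg s
  rw [randomize]
  refine Measure.ext_of_charFun <| funext fun t => ?_
  simp only [isoGaussian_eq_diagonal]
  rw [charFun_conv, charFun_multivariateGaussian (posSemidef _),
    charFun_multivariateGaussian (posSemidef _), charFun_multivariateGaussian (posSemidef _),
    ← Complex.exp_add, Real.sq_sqrt (by positivity), ← Matrix.diagonal_add, Matrix.add_mulVec,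
    dotProduct_add, inner_zero_right]
  congr 1
  push_cast
  ring

lemma isoGaussian_eq_map (m : EuclideanSpace ℝ (Fin d)) (s : ℝ) :
    isoGaussian m s = (Measure.pi fun _ => gaussianReal 0 1).map
      fun z => WithLp.toLp 2 fun i => s * z i + m i := by
  have affine_map (i : Fin d) : (gaussianReal 0 1).map (fun x => s * x + m i) =
      gaussianReal (m i) (s ^ 2).toNNReal := by
    rw [← Function.comp_def (· + m i) (s * ·), ← Measure.map_map (by fun_prop) (by fun_prop),
      gaussianReal_map_const_mul, gaussianReal_map_add_const, mul_zero, zero_add, mul_one,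
      Real.toNNReal_of_nonneg (sq_nonneg s)]
  have pi_map := Measure.pi_map_pi (μ := fun _ : Fin d => gaussianReal 0 1)
    (f := fun i x => s * x + m i) fun i => by fun_prop
  simp only [affine_map] at pi_map
  rw [isoGaussian_eq_diagonal, multivariateGaussian_diagonal m fun _ => sq_nonneg s, ← pi_map,
    Measure.map_map (by fun_prop) (by fun_prop)]
  rfl

lemma map_norm_sub_sq_div_isoGaussian (m : EuclideanSpace ℝ (Fin d)) (s t : ℝ) :
    (isoGaussian m t).map (fun x => ‖x - m‖ ^ 2 / s ^ 2) =
      (chiSquared d).map (t ^ 2 / s ^ 2 * ·) := by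
  rw [isoGaussian_eq_map, chiSquared, Measure.map_map (by fun_prop) (by fun_prop),
    Measure.map_map (by fun_prop) (by fun_prop)]
  congr 1
  ext z
  simp only [Function.comp_apply, EuclideanSpace.real_norm_sq_eq, PiLp.sub_apply,
    add_sub_cancel_right, mul_pow, ← Finset.mul_sum]
  ring

lemma tvDist_chiSquared_map_le (m : EuclideanSpace ℝ (Fin d)) {s : ℝ} (hs : s ≠ 0) (t : ℝ) :
    tvDist (chiSquared d) ((chiSquared d).map (t ^ 2 / s ^ 2 * ·)) ≤
      tvDist (isoGaussian m s) (isoGaussian m t) := by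
  have radial := tvDist_map_le (isoGaussian m s) (isoGaussian m t)
    (g := fun x => ‖x - m‖ ^ 2 / s ^ 2) (by fun_prop)
  rw [map_norm_sub_sq_div_isoGaussian, map_norm_sub_sq_div_isoGaussian,
    div_self (pow_ne_zero 2 hs)] at radial
  simpa only [one_mul, Measure.map_id'] using radial

lemma min_one_mul_le_log {y D : ℝ} (hy : 0 ≤ y) (hD : 1 ≤ D) :
    min 1 (y * D) ≤ 2 * (D * Real.log (1 + y)) := by
  have log_ge := mul_le_mul_of_nonneg_left (Real.le_log_one_add_of_nonneg hy) (by linarith : 0 ≤ D)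
  suffices min 1 (y * D) ≤ 2 * (D * (2 * y / (y + 2))) by linarith
  rw [← mul_div_assoc, ← mul_div_assoc, le_div_iff₀ (by positivity), mul_add]
  have le_one := mul_le_mul_of_nonneg_right (min_le_left 1 (y * D)) hy
  nlinarith [min_le_right 1 (y * D)]

lemma min_one_two_mul_div_le {y L : ℝ} (hy : 0 ≤ y) (hL : 0 < L) :
    min 1 (2 * y) / (2 * L + 1) ≤ y / (L + y) := by
  rw [div_le_div_iff₀ (by positivity) (by positivity)]
  obtain le | ge := le_total 1 (2 * y)
  · rw [min_eq_left le]
    nlinarith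
  · rw [min_eq_right ge]
    nlinarith

lemma exists_le_tvDist_randomize_isoGaussian : ∃ c : ℝ, 0 < c ∧
    ∀ (d : ℕ) (m : EuclideanSpace ℝ (Fin d)) (s σ : ℝ), s ≠ 0 →
      c * min 1 (σ ^ 2 / s ^ 2 * √d) ≤
        tvDist (isoGaussian m s) (randomize σ (isoGaussian m s)) := by
  obtain ⟨η, L, η_pos, L_pos, log_width⟩ := exists_chiSquared_log_width
  refine ⟨η / (2 * L + 1), by positivity, fun d m s σ hs => ?_⟩
  obtain rfl | d_pos := Nat.eq_zero_or_pos d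
  · simpa using tvDist_nonneg _ _
  obtain rfl | σ_ne := eq_or_ne σ 0
  · simpa using tvDist_nonneg _ _
  have one_le : 1 ≤ √(d : ℝ) := Real.one_le_sqrt.2 (by exact_mod_cast d_pos)
  set ρ := 1 + σ ^ 2 / s ^ 2
  have one_lt : 1 < ρ := lt_add_of_pos_right _ (by positivity)
  have log_pos : 0 < Real.log ρ := Real.log_pos one_lt
  have ratio : √(s ^ 2 + σ ^ 2) ^ 2 / s ^ 2 = ρ := by
    rw [Real.sq_sqrt (by positivity), add_div, div_self (pow_ne_zero 2 hs)]
  rw [randomize_isoGaussian]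
  obtain ⟨l, l_pos, mass⟩ := log_width d d_pos
  have dilation := measureReal_Ioc_mul_log_le_tvDist (ν := chiSquared d) l_pos.le
    (w := L / √d) (by positivity) one_lt
  calc η / (2 * L + 1) * min 1 (σ ^ 2 / s ^ 2 * √d)
      ≤ η / (2 * L + 1) * min 1 (2 * (√d * Real.log ρ)) := by
        refine mul_le_mul_of_nonneg_left (le_min (min_le_left _ _) ?_) (by positivity)
        exact min_one_mul_le_log (by positivity) one_le
    _ = η * (min 1 (2 * (√d * Real.log ρ)) / (2 * L + 1)) := by ring
    _ ≤ η * (√d * Real.log ρ / (L + √d * Real.log ρ)) := by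
        refine mul_le_mul_of_nonneg_left ?_ η_pos.le
        exact min_one_two_mul_div_le (by positivity) L_pos
    _ = η * Real.log ρ / (L / √d + Real.log ρ) := by field_simp
    _ ≤ tvDist (chiSquared d) ((chiSquared d).map (ρ * ·)) := by
        rw [div_le_iff₀' (by positivity)]
        exact (mul_le_mul_of_nonneg_right mass log_pos.le).trans dilation
    _ ≤ tvDist (isoGaussian m s) (isoGaussian m √(s ^ 2 + σ ^ 2)) :=
        ratio ▸ tvDist_chiSquared_map_le m hs _

lemma tvDist_randomize_isoGaussian_le (m : EuclideanSpace ℝ (Fin d)) {s : ℝ} (hs : s ≠ 0)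
    (σ : ℝ) :
    tvDist (isoGaussian m s) (randomize σ (isoGaussian m s)) ≤ σ ^ 2 / s ^ 2 * √d := by
  have s_pos : ∀ _ : Fin d, 0 < s ^ 2 := fun _ => by positivity
  have sum_pos : ∀ _ : Fin d, 0 < s ^ 2 + σ ^ 2 := fun _ => by positivity
  have sq_le := sq_tvDist_multivariateGaussian_le m m s_pos sum_pos
  simp only [sub_self, zero_pow two_ne_zero, zero_div, Finset.sum_const_zero, add_zero] at sq_le
  rw [randomize_isoGaussian, isoGaussian_eq_diagonal, isoGaussian_eq_diagonal,
    Real.sq_sqrt (by positivity)]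
  refine le_of_sq_le_sq ?_ (by positivity)
  set γ := covGap (Matrix.diagonal fun _ : Fin d => s ^ 2)
    (Matrix.diagonal fun _ => s ^ 2 + σ ^ 2)
  have covGap_le : γ ≤ (σ ^ 2 / s ^ 2 * √d) ^ 2 / 16 := by
    refine (covGap_diagonal_le s_pos sum_pos).trans ?_
    rw [Finset.sum_const, Finset.card_univ, Fintype.card_fin, nsmul_eq_mul, mul_pow,
      Real.sq_sqrt d.cast_nonneg, mul_comm, mul_div_right_comm, sub_add_cancel_left, neg_sq,
      div_pow, div_div, mul_comm _ (16 : ℝ)]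
    gcongr
    nlinarith [mul_nonneg (sq_nonneg s) (sq_nonneg σ)]
  nlinarith [Real.one_sub_le_exp_neg γ, sq_nonneg (σ ^ 2 / s ^ 2 * √d)]

end Randomization

section PrivacyLeakage

open scoped BigOperators

variable {Ω : Type*} [MeasurableSpace Ω] {K : ℕ}

lemma privacyLeakage_eq_one_sub_expect (hK : 0 < K) (PO PD : Fin K → Measure Ω) :
    privacyLeakage PO PD = 1 - 𝔼 k, tvDist (PO k) (PD k) := by
  rw [privacyLeakage, Fintype.expect_eq_sum_div_card, Finset.sum_sub_distrib, Finset.sum_const,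
    Finset.card_univ, Fintype.card_fin, nsmul_one, mul_sub, one_div_mul_cancel (by positivity),
    one_div_mul_eq_div]

lemma exists_privacyLeakage_eq_one_sub_min (hK : 0 < K) (PO PD : Fin K → Measure Ω)
    [∀ k, IsProbabilityMeasure (PO k)] [∀ k, IsProbabilityMeasure (PD k)] {l u : ℝ}
    (hl : ∀ k, l ≤ tvDist (PO k) (PD k)) (hu : ∀ k, tvDist (PO k) (PD k) ≤ u) :
    ∃ θ : ℝ, l ≤ θ ∧ θ ≤ u ∧ privacyLeakage PO PD = 1 - min 1 θ := by
  have := Fin.pos_iff_nonempty.1 hK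
  refine ⟨𝔼 k, tvDist (PO k) (PD k), Finset.le_expect Finset.univ_nonempty fun k _ => hl k,
    Finset.expect_le Finset.univ_nonempty fun k _ => hu k, ?_⟩
  rw [privacyLeakage_eq_one_sub_expect hK, min_eq_right]
  exact Finset.expect_le Finset.univ_nonempty fun k _ => tvDist_le_one _ _

end PrivacyLeakage

theorem proposition1 :
    -- Randomization, with `x = σ² / c_clip² * √d`
    (∃ c C : ℝ, 0 < c ∧ 0 < C ∧
      ∀ (K d : ℕ), 0 < K →
      ∀ (μ : Fin K → EuclideanSpace ℝ (Fin d)) (cclip σ : ℝ), 0 < cclip → 0 ≤ σ →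
        ∃ θ : ℝ,
          c * min 1 (σ ^ 2 / cclip ^ 2 * √(d : ℝ)) ≤ θ ∧
          θ ≤ C * (σ ^ 2 / cclip ^ 2 * √(d : ℝ)) ∧
          privacyLeakage (fun k => isoGaussian (μ k) cclip)
              (fun k => randomize σ (isoGaussian (μ k) cclip)) = 1 - min 1 θ) ∧
    -- Sparsification, with variances of the retained block in `[a, b]`
    (∀ a b : ℝ, 0 < a → a ≤ b → ∃ c C : ℝ, 0 < c ∧ 0 < C ∧
      ∀ (K q r : ℕ), 0 < K →
      ∀ (μu : Fin K → EuclideanSpace ℝ (Fin q)) (μo μg : Fin K → EuclideanSpace ℝ (Fin r))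
        (su : Fin K → Fin q → ℝ) (so sg : Fin K → Fin r → ℝ),
        (∀ k i, 0 < su k i) → (∀ k i, so k i ∈ Set.Icc a b) → (∀ k i, sg k i ∈ Set.Icc a b) →
        ∃ f : Fin K → ℝ,
          (∀ k, c * min 1 (‖μo k - μg k‖ ^ 2) ≤ f k ∧
            f k ≤ covGap (blockCov (su k) (so k)) (blockCov (su k) (sg k))
              + C * ‖μo k - μg k‖ ^ 2 ∧
            f k ≤ covGap (blockCov (su k) (so k)) (blockCov (su k) (sg k))
              + C * ‖μo k - μg k‖) ∧
          privacyLeakage (fun k => blockGaussian (μu k) (μo k) (su k) (so k))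
              (fun k => blockGaussian (μu k) (μg k) (su k) (sg k))
            = (1 / (K : ℝ)) * ∑ k, (1 - √2 * √(1 - Real.exp (-f k)))) := by
  refine ⟨?randomization, fun a b ha hab => ?sparsification⟩
  case randomization =>
    obtain ⟨c, c_pos, le_tv⟩ := exists_le_tvDist_randomize_isoGaussian
    refine ⟨c, 1, c_pos, one_pos, fun K d hK μ cclip σ hcclip _ => ?_⟩
    exact exists_privacyLeakage_eq_one_sub_min hK _ _
      (fun k => le_tv d (μ k) cclip σ hcclip.ne')
      fun k => (tvDist_randomize_isoGaussian_le (μ k) hcclip.ne' σ).trans_eq (one_mul _).symm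
  case sparsification =>
    have hb := ha.trans_le hab
    refine ⟨gaussianPDFReal 0 1 1 ^ 2 / 2 * min 1 (1 / b), 1 / (8 * a) + 1, ?_, by positivity,
      fun K q r _ μu μo μg su so sg hu ho hg => ⟨fun k => hellingerExponent
        (tvDist (blockGaussian (μu k) (μo k) (su k) (so k))
          (blockGaussian (μu k) (μg k) (su k) (sg k))), fun k => ⟨?_, ?_, ?_⟩, ?_⟩⟩
    · have := gaussianPDFReal_pos 0 1 1 one_ne_zero
      positivity
    · exact le_hellingerExponent_blockGaussian _ _ _ hb (hu k)
        (fun i => ha.le.trans (ho k i).1) fun i => ⟨ha.trans_le (hg k i).1, (hg k i).2⟩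
    · exact hellingerExponent_blockGaussian_le_add_sq _ _ _ ha (hu k)
        (fun i => (ho k i).1) fun i => (hg k i).1
    · exact hellingerExponent_blockGaussian_le_add_norm _ _ _ ha (hu k)
        (fun i => (ho k i).1) fun i => (hg k i).1
    · simp only [privacyLeakage, sqrt_two_mul_sqrt_one_sub_exp_neg_hellingerExponent
        (tvDist_blockGaussian_mem_Icc _ _ _)]
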